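/- Let $(\Omega,\mathcal F,P)$ be a probability space; random variables are identified when they agree $P$-a.s., and (in)equalities hold $P$-a.s. Let $L^\infty_{++}$ be the set of random variables $X$ with $a\le X\le b$ for some constants $0<a\le b<\infty$ (equivalently $X>0$ and $\log X\in L^\infty$). Let $\mathcal Q_P$ be the set of all probability measures on $(\Omega,\mathcal F)$ absolutely continuous with respect to $P$. Let $\tilde\rho:L^\infty_{++}\to[0,\infty]$. We call $\tilde\rho$ - monotone if $X\le Y$ implies $\tilde\rho(X)\le\tilde\rho(Y)$; - positively homogeneous if $\tilde\rho(\lambda X)=\lambda\tilde\rho(X)$ for all $\lambda>0$ and $X\in L^\infty_{++}$; - quasi-logconvex if $\tilde\rho(X^\alpha Y^{1-\alpha})\le\max\{\tilde\rho(X),\tilde\rho(Y)\}$ for all $X,Y\in L^\infty_{++}$, $\alpha\in(0,1)$; - logconvex if it is monotone, positively homogeneous and $\tilde\rho(X^\alpha Y^{1-\alpha})\le\tilde\rho(X)^\alpha\tilde\rho(Y)^{1-\alpha}$ for all $X,Y\in L^\infty_{++}$, $\alpha\in(0,1)$; - continuous from below if $X_n\uparrow X$ $P$-a.s. with $X_n,X\in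 L^\infty_{++}$ implies $\tilde\rho(X_n)\to\tilde\rho(X)$. For $\mathcal Q\subseteq\mathcal Q_P$, a functional $\mathfrak R:\mathbb R\times\mathcal Q\to[-\infty,\infty]$ represents $\tilde\rho$ if $t\mapsto\mathfrak R(t;Q)$ is increasing and continuous from below for each $Q\in\mathcal Q$ and $$\tilde\rho(X)=\sup_{Q\in\mathcal Q}\exp\big(\mathfrak R(\mathbb E_Q[\log X];Q)\big)\qquad(X\in L^\infty_{++}),$$ with $\exp(-\infty)=0$ and $\exp(\infty)=\infty$. A functional $\tilde{\mathfrak R}:\mathbb R\times\mathcal Q\to[0,\infty]$ exp-represents $\tilde\rho$ if it is increasing and continuous from below in $t$ for each $Q$ and $\tilde\rho(X)=\sup_{Q\in\mathcal Q}\tilde{\mathfrak R}(\mathbb E_Q[\log X];Q)$ for all $X\in L^\infty_{++}$. **Theorem.** (1) The following are equivalent: (a) $\tilde\rho$ is monotone, quasi-logconvex, continuous from below and positively homogeneous; (a') $\tilde\rho$ is logconvex and continuous from below; (b) some $\mathfrak R:\mathbb R\times\mathcal Q\to[-\infty,\infty]$, with $\mathcal Q\subseteq\mathcal Q_P$, represents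 $\tilde\rho$ and is translation invariant: $\mathfrak R(t+h;Q)=\mathfrak R(t;Q)+h$ for all $t,h\in\mathbb R$, $Q\in\mathcal Q$; (c) some $\tilde{\mathfrak R}:\mathbb R\times\mathcal Q\to[0,\infty]$, with $\mathcal Q\subseteq\mathcal Q_P$, exp-represents $\tilde\rho$ and is multiplicatively homogeneous: $\tilde{\mathfrak R}(t+h;Q)=e^h\tilde{\mathfrak R}(t;Q)$ for all $t,h\in\mathbb R$, $Q\in\mathcal Q$. (2) For any $\mathcal Q\subseteq\mathcal Q_P$ and $\mathfrak R:\mathbb R\times\mathcal Q\to[-\infty,\infty]$: $\mathfrak R$ is as in (b) if and only if $\tilde{\mathfrak R}=\exp\mathfrak R$ is as in (c). (3) Put $c_{\min}(Q)=\sup_{Z\in L^\infty}\{\mathbb E_Q[Z]-\log\tilde\rho(e^Z)\}\in[-\infty,\infty]$ for $Q\in\mathcal Q_P$. Every $\mathfrak R$ as in (b) has the form $\mathfrak R(t;Q)=t-c(Q)$ for $t\in\mathbb R$, $Q\in\mathcal Q$, with some $c:\mathcal Q\to[-\infty,\infty]$ satisfying $c\ge c_{\min}$ on $\mathcal Q$.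 (4) If (a) holds, then (b) holds with $\mathcal Q=\mathcal Q_P$ and $$\mathfrak R(t;Q)=\inf\{\log\tilde\rho(Y):\ Y\in L^\infty_{++},\ \mathbb E_Q[\log Y]\ge t\},$$ and this $\mathfrak R$ satisfies $\mathfrak R(t;Q)=t-c_{\min}(Q)$ for all $t\in\mathbb R$, $Q\in\mathcal Q_P$. -/

import Mathlib

open MeasureTheory Filter Topology
open scoped ENNReal

noncomputable section

namespace RiskMeasure

variable {Ω : Type*} [MeasurableSpace Ω]

/-- `L^∞_{++}(Ω, 𝓕, P)`: the `P`-a.s. equivalence classes of real random variables that are `P`-a.s.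
bounded and strictly positive, in the sense that they are bounded above and bounded away from `0`
(that is, `log X ∈ L^∞`, so that `exp : L^∞ → L^∞_{++}` is a bijection).
The order is the `P`-a.s. order. -/
abbrev PosLinf (P : Measure Ω) : Type _ :=
  {X : Ω →ₘ[P] ℝ // ∃ a b : ℝ, 0 < a ∧ ∀ᵐ ω ∂P, a ≤ X ω ∧ X ω ≤ b}

/-- Probability measures on `Ω` that are absolutely continuous with respect to `P`. -/
abbrev ACProb (P : Measure Ω) : Type _ :=
  {Q : Measure Ω // IsProbabilityMeasure Q ∧ Q ≪ P}

variable {P : Measure Ω}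

/-- The multiple `lam • X` of `X ∈ L^∞_{++}`, for a real `lam > 0`. -/
def PosLinf.scale (lam : ℝ) (hlam : 0 < lam) (X : PosLinf P) : PosLinf P :=
  ⟨AEEqFun.mk (fun ω => lam * X.1 ω) (X.1.aestronglyMeasurable.const_mul lam), by
    obtain ⟨a, b, ha, h⟩ := X.2
    refine ⟨lam * a, lam * b, mul_pos hlam ha, ?_⟩
    filter_upwards [h, AEEqFun.coeFn_mk (fun ω => lam * X.1 ω)
      (X.1.aestronglyMeasurable.const_mul lam)] with ω hω hmk
    rw [hmk]
    exact ⟨mul_le_mul_of_nonneg_left hω.1 hlam.le, mul_le_mul_of_nonneg_left hω.2 hlam.le⟩⟩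

theorem aestronglyMeasurable_geom (α : ℝ) (X Y : PosLinf P) :
    AEStronglyMeasurable (fun ω => X.1 ω ^ α * Y.1 ω ^ (1 - α)) P :=
  ((X.1.aestronglyMeasurable.aemeasurable.pow_const α).mul
    (Y.1.aestronglyMeasurable.aemeasurable.pow_const (1 - α))).aestronglyMeasurable

/-- The geometric mixture `X^α Y^{1-α}` of `X, Y ∈ L^∞_{++}`, for `α ∈ (0,1)`. -/
def PosLinf.geom (α : ℝ) (hα : α ∈ Set.Ioo (0 : ℝ) 1) (X Y : PosLinf P) : PosLinf P :=
  ⟨AEEqFun.mk (fun ω => X.1 ω ^ α * Y.1 ω ^ (1 - α)) (aestronglyMeasurable_geom α X Y), by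
    obtain ⟨a, b, ha, h⟩ := X.2
    obtain ⟨a', b', ha', h'⟩ := Y.2
    have hα0 : 0 ≤ α := hα.1.le
    have hα1 : 0 ≤ 1 - α := sub_nonneg.2 hα.2.le
    refine ⟨a ^ α * a' ^ (1 - α), b ^ α * b' ^ (1 - α), by positivity, ?_⟩
    filter_upwards [h, h', AEEqFun.coeFn_mk _ (aestronglyMeasurable_geom α X Y)]
      with ω hω hω' hmk
    rw [hmk]
    have hX : 0 < X.1 ω := ha.trans_le hω.1
    have hY : 0 < Y.1 ω := ha'.trans_le hω'.1
    have hb : 0 < b := hX.trans_le hω.2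
    constructor
    · exact mul_le_mul (Real.rpow_le_rpow ha.le hω.1 hα0) (Real.rpow_le_rpow ha'.le hω'.1 hα1)
        (by positivity) (by positivity)
    · exact mul_le_mul (Real.rpow_le_rpow hX.le hω.2 hα0) (Real.rpow_le_rpow hY.le hω'.2 hα1)
        (by positivity) (by positivity)⟩

theorem aestronglyMeasurable_exp (Z : Lp ℝ ∞ P) :
    AEStronglyMeasurable (fun ω => Real.exp (Z ω)) P :=
  Real.continuous_exp.comp_aestronglyMeasurable (Lp.aestronglyMeasurable Z)

/-- The exponential `exp Z ∈ L^∞_{++}` of `Z ∈ L^∞`. -/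
def expLinf (Z : Lp ℝ ∞ P) : PosLinf P :=
  ⟨AEEqFun.mk (fun ω => Real.exp (Z ω)) (aestronglyMeasurable_exp Z), by
    refine ⟨Real.exp (-‖Z‖), Real.exp ‖Z‖, Real.exp_pos _, ?_⟩
    have hZ : ∀ᵐ ω ∂P, ‖Z ω‖ ≤ ‖Z‖ := by
      have hfin : eLpNormEssSup Z P ≠ ∞ := by
        have := Lp.eLpNorm_ne_top Z
        rwa [eLpNorm_exponent_top] at this
      filter_upwards [ae_le_eLpNormEssSup (f := Z) (μ := P)] with ω hω
      rw [Lp.norm_def, eLpNorm_exponent_top]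
      have := ENNReal.toReal_mono hfin hω
      simpa using this
    filter_upwards [hZ, AEEqFun.coeFn_mk _ (aestronglyMeasurable_exp Z)] with ω hω hmk
    rw [hmk]
    have := abs_le.1 hω
    exact ⟨Real.exp_le_exp.2 this.1, Real.exp_le_exp.2 this.2⟩⟩

/-- `E_Q[log X]`, for `X ∈ L^∞_{++}(P)` and `Q ≪ P`. -/
def expLog (Q : ACProb P) (X : PosLinf P) : ℝ := ∫ ω, Real.log (X.1 ω) ∂Q.1

/-! ### Properties of a map `rho : L^∞_{++} → [0, ∞]` -/

/-- `rho (lam X) = lam rho(X)` for all `lam > 0` (the `lam` with `lam X ∈ L^∞_{++}`). -/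
def PositivelyHomogeneous (rho : PosLinf P → ℝ≥0∞) : Prop :=
  ∀ (lam : ℝ) (hlam : 0 < lam) (X : PosLinf P),
    rho (X.scale lam hlam) = ENNReal.ofReal lam * rho X

/-- `rho (X^α Y^{1-α}) ≤ max {rho X, rho Y}`. -/
def QuasiLogconvex (rho : PosLinf P → ℝ≥0∞) : Prop :=
  ∀ (α : ℝ) (hα : α ∈ Set.Ioo (0 : ℝ) 1) (X Y : PosLinf P),
    rho (PosLinf.geom α hα X Y) ≤ max (rho X) (rho Y)

/-- Logconvexity: `rho` is monotone, positively homogeneous and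
`rho (X^α Y^{1-α}) ≤ rho(X)^α rho(Y)^{1-α}`. -/
def Logconvex (rho : PosLinf P → ℝ≥0∞) : Prop :=
  Monotone rho ∧ PositivelyHomogeneous rho ∧
    ∀ (α : ℝ) (hα : α ∈ Set.Ioo (0 : ℝ) 1) (X Y : PosLinf P),
      rho (PosLinf.geom α hα X Y) ≤ rho X ^ α * rho Y ^ (1 - α)

/-- `X_n ↑ X` (`P`-a.s.) in `L^∞_{++}` implies `rho (X_n) → rho X`. -/
def ContinuousFromBelow (rho : PosLinf P → ℝ≥0∞) : Prop :=
  ∀ (X : ℕ → PosLinf P) (Y : PosLinf P), Monotone X →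
    (∀ᵐ ω ∂P, Tendsto (fun n => (X n).1 ω) atTop (𝓝 (Y.1 ω))) →
    Tendsto (fun n => rho (X n)) atTop (𝓝 (rho Y))

/-! ### Dual representations -/

/-- `rho X = sup_{Q ∈ 𝓠} exp (R (E_Q[log X]; Q))`, with `R : ℝ × 𝓠 → [-∞, ∞]` increasing and
continuous from below in the first variable. -/
def DualRep (rho : PosLinf P → ℝ≥0∞) (𝓠 : Set (ACProb P)) (R : ℝ → 𝓠 → EReal) : Prop :=
  (∀ Q : 𝓠, Monotone fun t => R t Q) ∧
  (∀ (Q : 𝓠) (t : ℝ), ContinuousWithinAt (fun s => R s Q) (Set.Iic t) t) ∧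
  ∀ X : PosLinf P, rho X = ⨆ Q : 𝓠, EReal.exp (R (expLog Q.1 X) Q)

/-- `rho X = sup_{Q ∈ 𝓠} S (E_Q[log X]; Q)`, with `S : ℝ × 𝓠 → [0, ∞]` increasing and
continuous from below in the first variable. -/
def DualRepExp (rho : PosLinf P → ℝ≥0∞) (𝓠 : Set (ACProb P)) (S : ℝ → 𝓠 → ℝ≥0∞) : Prop :=
  (∀ Q : 𝓠, Monotone fun t => S t Q) ∧
  (∀ (Q : 𝓠) (t : ℝ), ContinuousWithinAt (fun s => S s Q) (Set.Iic t) t) ∧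
  ∀ X : PosLinf P, rho X = ⨆ Q : 𝓠, S (expLog Q.1 X) Q

/-- `R (t + h; Q) = R (t; Q) + h` for all `t, h ∈ ℝ` and `Q ∈ 𝓠`. -/
def TranslationInvariant {𝓠 : Set (ACProb P)} (R : ℝ → 𝓠 → EReal) : Prop :=
  ∀ (t h : ℝ) (Q : 𝓠), R (t + h) Q = R t Q + (h : EReal)

/-- `S (t + h; Q) = e^h S (t; Q)` for all `t, h ∈ ℝ` and `Q ∈ 𝓠`. -/
def MultiplicativelyHomogeneous {𝓠 : Set (ACProb P)} (S : ℝ → 𝓠 → ℝ≥0∞) : Prop :=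
  ∀ (t h : ℝ) (Q : 𝓠), S (t + h) Q = ENNReal.ofReal (Real.exp h) * S t Q

/-- `inf {log (rho Y) : Y ∈ L^∞_{++}, E_Q[log Y] ≥ t}`. -/
def canonicalR (rho : PosLinf P → ℝ≥0∞) (t : ℝ) (Q : ACProb P) : EReal :=
  ⨅ (Y : PosLinf P) (_ : t ≤ expLog Q Y), ENNReal.log (rho Y)

/-- The arithmetic counterpart `Z ↦ log (rho (exp Z))`, from `L^∞` to `[-∞, ∞]`. -/
def arithmetic (rho : PosLinf P → ℝ≥0∞) (Z : Lp ℝ ∞ P) : EReal :=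
  ENNReal.log (rho (expLinf Z))

/-- The minimal penalty `c(Q) = sup_{Z ∈ L^∞} (E_Q[Z] - log (rho (exp Z)))`. -/
def minimalPenalty (rho : PosLinf P → ℝ≥0∞) (Q : ACProb P) : EReal :=
  ⨆ Z : Lp ℝ ∞ P, (((∫ ω, Z ω ∂Q.1 : ℝ) : EReal) - arithmetic rho Z)

end RiskMeasure

end

/-! Put `Z = log X`. Geometric mixtures become convex combinations, so quasi-logconvexity says that
the level sets `logLevel rho b` in `L^∞` are convex. Monotonicity makes them downward closed, and
continuity from below makes them closed under bounded a.s. limits.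

The core is `exists_acProb_integral_lt`: a point outside such a set is strictly separated from it by
some `Q ≪ P`. Weak-* duality of `L^∞` is avoided. An exhaustion builds a finite `μ ≪ P` for which
the point keeps a positive `L²(μ)` distance from the set. Hahn–Banach in the Hilbert space `L²(μ)`
then gives a density, nonnegative because the set is downward closed.

Applied to the level sets below `rho X`, this gives `rho X = sup_Q exp (canonicalR rho (E_Q[log X])
Q)` (`eq_iSup_exp_canonicalR`). Positive homogeneity turns `canonicalR rho t Q` into `t -
minimalPenalty rho Q`, whence translation invariance and continuity in `t`.

Conversely, a multiplicatively homogeneous `S` equals `e^t S(0; Q)`, so each term of the supremum is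
log-affine in `X` and the supremum is logconvex. Continuity from below follows from monotone
convergence and an exchange of suprema. The exponential is an order isomorphism and a homeomorphism
from `[-∞, ∞]` to `[0, ∞]`, which links `R` and `exp R`. -/

namespace RiskMeasure

/-! ### Separation in a Hilbert space -/

section Hilbert

variable {H : Type*} [NormedAddCommGroup H] [InnerProductSpace ℝ H] [CompleteSpace H]

/-- A decreasing sequence of nonempty bounded closed convex sets in a Hilbert space has a common
point. -/
theorem nonempty_iInter_of_antitone_convex {C : ℕ → Set H} (hanti : Antitone C)
    (hclosed : ∀ n, IsClosed (C n)) (hconv : ∀ n, Convex ℝ (C n)) (hne : ∀ n, (C n).Nonempty)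
    (hbdd : Bornology.IsBounded (C 0)) : (⋂ n, C n).Nonempty := by
  -- The points of least norm form a Cauchy sequence: their norms increase and are bounded, and the
  -- midpoint of `x n` and `x m` stays in `C n`, so the parallelogram law controls `‖x n - x m‖`.
  have hmin : ∀ n, ∃ x ∈ C n, ∀ y ∈ C n, ‖x‖ ≤ ‖y‖ := by
    intro n
    obtain ⟨x, hx, hxn⟩ := exists_norm_eq_iInf_of_complete_convex (hne n)
      (hclosed n).isComplete (hconv n) 0
    refine ⟨x, hx, fun y hy => ?_⟩
    have hle : (⨅ w : C n, ‖(0 : H) - w‖) ≤ ‖(0 : H) - y‖ :=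
      ciInf_le ⟨0, by rintro _ ⟨w, rfl⟩; exact norm_nonneg _⟩ (⟨y, hy⟩ : C n)
    rw [← hxn] at hle
    simpa using hle
  choose x hx hxmin using hmin
  have hmono : Monotone fun n => ‖x n‖ := fun n m hnm => hxmin n _ (hanti hnm (hx m))
  obtain ⟨R, hR⟩ := hbdd.exists_norm_le
  have hbd : BddAbove (Set.range fun n => ‖x n‖) := by
    refine ⟨R, ?_⟩
    rintro _ ⟨n, rfl⟩
    exact hR _ (hanti (Nat.zero_le n) (hx n))
  have hlim := (tendsto_atTop_ciSup hmono hbd).pow 2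
  have hdist : ∀ n m, n ≤ m → ‖x n - x m‖ ^ 2 ≤ 2 * (‖x m‖ ^ 2 - ‖x n‖ ^ 2) := by
    intro n m hnm
    have hmid : (1 / 2 : ℝ) • x n + (1 / 2 : ℝ) • x m ∈ C n :=
      hconv n (hx n) (hanti hnm (hx m)) (by norm_num) (by norm_num) (by norm_num)
    have h1 := hxmin n _ hmid
    rw [← smul_add, norm_smul] at h1
    norm_num at h1
    have h2 := parallelogram_law_with_norm ℝ (x n) (x m)
    nlinarith [norm_nonneg (x n), norm_nonneg (x n + x m)]
  have hcauchy : CauchySeq x := by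
    rw [Metric.cauchySeq_iff']
    intro ε hε
    obtain ⟨N, hN⟩ := Metric.cauchySeq_iff'.1 hlim.cauchySeq (ε ^ 2 / 2) (by positivity)
    refine ⟨N, fun n hn => ?_⟩
    have h1 := hdist N n hn
    have h2 := (abs_lt.1 (Real.dist_eq _ _ ▸ hN n hn)).2
    rw [dist_comm, dist_eq_norm]
    exact lt_of_pow_lt_pow_left₀ 2 hε.le (by linarith)
  obtain ⟨y, hy⟩ := cauchySeq_tendsto_of_complete hcauchy
  refine ⟨y, Set.mem_iInter.2 fun n => (hclosed n).mem_of_tendsto hy ?_⟩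
  filter_upwards [eventually_ge_atTop n] with m hm using hanti hm (hx m)

/-- Two disjoint closed convex sets in a Hilbert space, the first of them
bounded, are separated by a vector. -/
theorem exists_inner_lt_of_disjoint {C S : Set H} (hCc : IsClosed C) (hC : Convex ℝ C)
    (hCb : Bornology.IsBounded C) (hSc : IsClosed S) (hS : Convex ℝ S)
    (hCS : Disjoint C S) :
    ∃ (f : H) (u : ℝ), (∀ V ∈ S, inner ℝ f V < u) ∧ ∀ U ∈ C, u ≤ inner ℝ f U := by
  -- Boundedness of `C` forces a positive distance: otherwise the sets `C ∩ cthickening (1/(n+1)) S`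
  -- are nonempty and decreasing, and a common point lies in both `C` and `S`.
  have hδ : ∃ δ > 0, Disjoint (Metric.thickening δ S) C := by
    by_contra! hcon
    have hne : (⋂ n : ℕ, C ∩ Metric.cthickening (1 / ((n : ℝ) + 1)) S).Nonempty := by
      refine nonempty_iInter_of_antitone_convex ?_ (fun n => hCc.inter Metric.isClosed_cthickening)
        (fun n => hC.inter (hS.cthickening _)) (fun n => ?_) (hCb.subset Set.inter_subset_left)
      · intro n m hnm
        exact Set.inter_subset_inter_right _
          (Metric.cthickening_mono (one_div_le_one_div_of_le (by positivity) (by gcongr)) _)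
      · obtain ⟨z, hz, hz'⟩ := Set.not_disjoint_iff.1 (hcon (1 / ((n : ℝ) + 1)) (by positivity))
        exact ⟨z, hz', Metric.thickening_subset_cthickening _ _ hz⟩
    obtain ⟨z, hz⟩ := hne
    rw [Set.mem_iInter] at hz
    refine Set.disjoint_left.1 hCS (hz 0).1 ?_
    rw [← hSc.closure_eq, Metric.mem_closure_iff_infEDist_zero]
    refine le_antisymm (ge_of_tendsto' (x := atTop) (f := fun n : ℕ =>
      ENNReal.ofReal (1 / ((n : ℝ) + 1))) ?_ fun n => (hz n).2) bot_le
    simpa [Function.comp_def] using (ENNReal.continuous_ofReal.tendsto 0).comp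
      (tendsto_one_div_add_atTop_nhds_zero_nat (𝕜 := ℝ))
  obtain ⟨δ, hδ0, hδ⟩ := hδ
  obtain ⟨φ, u, h1, h2⟩ := geometric_hahn_banach_open (hS.thickening δ)
    Metric.isOpen_thickening hC hδ
  refine ⟨(InnerProductSpace.toDual ℝ H).symm φ, u, fun V hV => ?_, fun U hU => ?_⟩
  · rw [InnerProductSpace.toDual_symm_apply]
    exact h1 V (Metric.self_subset_thickening hδ0 S hV)
  · rw [InnerProductSpace.toDual_symm_apply]
    exact h2 U hU

end Hilbert

variable {Ω : Type*} [MeasurableSpace Ω]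

/-! ### Separation in `L²` -/

instance instPosSMulMonoLp {p : ℝ≥0∞} {P : Measure Ω} : PosSMulMono ℝ (Lp ℝ p P) :=
  PosSMulMono.of_smul_nonneg fun a ha U hU => (Lp.coeFn_nonneg _).1 <| by
    filter_upwards [Lp.coeFn_smul a U, (Lp.coeFn_nonneg U).2 hU] with ω h1 h2
    rw [h1]
    exact mul_nonneg ha h2

theorem le_const_iff_ae_le {p : ℝ≥0∞} {P : Measure Ω} [IsFiniteMeasure P] {U : Lp ℝ p P} {M : ℝ} :
    U ≤ Lp.const p P M ↔ ∀ᵐ ω ∂P, U ω ≤ M := by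
  rw [← Lp.coeFn_le]
  constructor
  · intro h
    filter_upwards [h, Lp.coeFn_const p P M] with ω h1 h2
    rwa [h2] at h1
  · intro h
    filter_upwards [h, Lp.coeFn_const p P M] with ω h1 h2
    rwa [h2]

theorem inner_const_L2 {P : Measure Ω} [IsFiniteMeasure P] (f : Lp ℝ 2 P) (c : ℝ) :
    inner ℝ f (Lp.const 2 P c) = c * ∫ ω, f ω ∂P := by
  rw [L2.inner_def, ← integral_const_mul]
  refine integral_congr_ae ?_
  filter_upwards [Lp.coeFn_const 2 P c] with ω hω
  rw [hω]
  simp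

theorem inner_L2_eq_integral_mul {P : Measure Ω} (f g : Lp ℝ 2 P) :
    inner ℝ f g = ∫ ω, f ω * g ω ∂P := by
  rw [L2.inner_def]
  simp [mul_comm]

theorem inner_L2_nonneg {P : Measure Ω} {f g : Lp ℝ 2 P} (hf : 0 ≤ f) (hg : 0 ≤ g) :
    0 ≤ inner ℝ f g := by
  rw [inner_L2_eq_integral_mul]
  refine integral_nonneg_of_ae ?_
  filter_upwards [(Lp.coeFn_nonneg f).2 hf, (Lp.coeFn_nonneg g).2 hg] with ω h1 h2
  exact mul_nonneg h1 h2

/-- An element of `L²` with nonnegative inner products against the indicators is nonnegative. -/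
theorem L2_nonneg_of_setIntegral {P : Measure Ω} [IsFiniteMeasure P] {f : Lp ℝ 2 P}
    (h : ∀ s, MeasurableSet s → 0 ≤ ∫ ω in s, f ω ∂P) : 0 ≤ f :=
  (Lp.coeFn_nonneg f).1 (ae_nonneg_of_forall_setIntegral_nonneg
    ((Lp.memLp f).integrable (by norm_num)) fun s hs _ => h s hs)

theorem inner_indicatorConstLp_one_right {P : Measure Ω} [IsFiniteMeasure P] (f : Lp ℝ 2 P)
    {s : Set Ω} (hs : MeasurableSet s) :
    inner ℝ f (indicatorConstLp 2 hs (measure_ne_top P s) (1 : ℝ)) = ∫ ω in s, f ω ∂P := by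
  rw [real_inner_comm, L2.inner_indicatorConstLp_one]

/-- If a linear functional is bounded below along a ray, it is nonnegative in its direction. -/
theorem nonneg_of_forall_le_add_mul {a b u : ℝ} (h : ∀ t : ℝ, 0 ≤ t → u ≤ a + t * b) : 0 ≤ b := by
  by_contra! hb
  have := h ((a - u + 1 + |a - u|) / (-b)) (div_nonneg (by linarith [neg_abs_le (a - u)]) (by linarith))
  rw [div_mul_eq_mul_div, div_neg, mul_div_assoc, div_self hb.ne] at this
  linarith [neg_abs_le (a - u), abs_nonneg (a - u)]

/-- Separate `C` from the order interval below the constant `r`. That interval is stable under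
subtracting nonnegative functions, so the separating vector is nonnegative. Testing it at `r` bounds
its mean, which is the mass estimate of the exhaustion below. -/
theorem exists_nonneg_one_lt_inner {P : Measure Ω} [IsFiniteMeasure P] {C : Set (Lp ℝ 2 P)}
    (hCc : IsClosed C) (hC : Convex ℝ C) (hCb : Bornology.IsBounded C) {r : ℝ} (hr : 0 < r)
    (h : ∀ U ∈ C, ¬ U ≤ Lp.const 2 P r) :
    ∃ f : Lp ℝ 2 P, 0 ≤ f ∧ ∫ ω, f ω ∂P ≤ 1 / r ∧ ∀ U ∈ C, 1 < inner ℝ f U := by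
  rcases C.eq_empty_or_nonempty with rfl | ⟨U₀, hU₀⟩
  · refine ⟨0, le_rfl, ?_, by simp⟩
    rw [integral_congr_ae (Lp.coeFn_zero ℝ 2 P)]
    simp [hr.le]
  obtain ⟨f, u, hS, hU⟩ := exists_inner_lt_of_disjoint (S := Set.Iic (Lp.const 2 P r)) hCc hC hCb
    isClosed_Iic (convex_Iic _) (Set.disjoint_left.2 h)
  have hf : 0 ≤ f := by
    refine L2_nonneg_of_setIntegral fun s hs => ?_
    refine nonneg_of_forall_le_add_mul (a := -(r * ∫ ω, f ω ∂P)) (u := -u) fun t ht => ?_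
    have hmem : Lp.const 2 P r - t • indicatorConstLp 2 hs (measure_ne_top P s) (1 : ℝ)
        ≤ Lp.const 2 P r := by
      refine sub_le_self _ (smul_nonneg ht ((Lp.coeFn_nonneg _).1 ?_))
      filter_upwards [indicatorConstLp_coeFn (p := 2) (hs := hs) (hμs := measure_ne_top P s)
        (c := (1 : ℝ))] with ω hω
      rw [hω]
      exact Set.indicator_nonneg (fun _ _ => zero_le_one) _
    have := hS _ hmem
    rw [inner_sub_right, inner_smul_right, inner_const_L2, inner_indicatorConstLp_one_right] at this
    linarith
  have hI : r * ∫ ω, f ω ∂P < u := by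
    rw [← inner_const_L2]
    exact hS _ (Set.mem_Iic.2 le_rfl)
  have hI0 : 0 ≤ ∫ ω, f ω ∂P := integral_nonneg_of_ae ((Lp.coeFn_nonneg f).2 hf)
  have hu : 0 < u := (mul_nonneg hr.le hI0).trans_lt hI
  -- Scaling by a `v` strictly below `u` makes the final inequality strict.
  obtain ⟨v, hv1, hv2⟩ := exists_between hI
  have hv : 0 < v := (mul_nonneg hr.le hI0).trans_lt hv1
  refine ⟨v⁻¹ • f, smul_nonneg (inv_nonneg.2 hv.le) hf, ?_, fun U hUC => ?_⟩
  · rw [integral_congr_ae (Lp.coeFn_smul v⁻¹ f)]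
    simp only [Pi.smul_apply, smul_eq_mul]
    rw [integral_const_mul, inv_mul_le_iff₀ hv, mul_one_div, le_div_iff₀ hr]
    linarith
  · rw [real_inner_smul_left, inv_mul_eq_div, lt_div_iff₀ hv, one_mul]
    exact hv2.trans_le (hU U hUC)

/-- Bounded parts of `L²` in the order sense are bounded in norm. -/
theorem isBounded_setOf_nonneg_le_const {P : Measure Ω} [IsFiniteMeasure P] (M : ℝ) :
    Bornology.IsBounded {U : Lp ℝ 2 P | 0 ≤ U ∧ U ≤ Lp.const 2 P M} := by
  refine isBounded_iff_forall_norm_le.2 ⟨‖Lp.const 2 P M‖, fun U hU => ?_⟩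
  refine norm_le_norm_of_abs_le_abs ?_
  rw [abs_of_nonneg hU.1]
  exact hU.2.trans (le_abs_self _)

/-- Kreĭn–Šmulian-type exhaustion: a convex set of bounded nonnegative elements of `L²`, whose
order-bounded parts are closed and which contains no small constant bound, is uniformly bounded
away from `0` in the mean for some finite measure `μ ≪ P`. -/
theorem exists_finite_measure_one_le_lintegral {P : Measure Ω} [IsFiniteMeasure P]
    {D : Set (Lp ℝ 2 P)} (hD : Convex ℝ D) (hD0 : ∀ U ∈ D, 0 ≤ U)
    (hDM : ∀ U ∈ D, ∃ M : ℝ, U ≤ Lp.const 2 P M)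
    (hDc : ∀ M : ℝ, IsClosed {U ∈ D | U ≤ Lp.const 2 P M})
    {r : ℝ} (hr : 0 < r) (hDr : ∀ U ∈ D, ¬ U ≤ Lp.const 2 P r) :
    ∃ μ : Measure Ω, IsFiniteMeasure μ ∧ μ ≪ P ∧
      ∀ U ∈ D, 1 ≤ ∫⁻ ω, ENNReal.ofReal (U ω) ∂μ := by
  -- Invariant of the exhaustion: `h` handles every element of `D` below `r * 2 ^ n`. Doubling the
  -- bound makes the masses of the successive corrections summable.
  let I : ℕ → Lp ℝ 2 P → Prop := fun n h =>
    0 ≤ h ∧ ∀ U ∈ D, U ≤ Lp.const 2 P (r * 2 ^ n) → 1 < inner ℝ h U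
  have hstep : ∀ (n : ℕ) (h : Lp ℝ 2 P), I n h → ∃ f : Lp ℝ 2 P, 0 ≤ f ∧
      ∫ ω, f ω ∂P ≤ 1 / (r * 2 ^ n) ∧ I (n + 1) (h + f) := by
    rintro n h ⟨h0, hI⟩
    -- Only the elements that `h` fails to handle need a correction; by the invariant none of them
    -- lies below `r * 2 ^ n`.
    obtain ⟨f, hf0, hfI, hf⟩ := exists_nonneg_one_lt_inner (P := P) (r := r * 2 ^ n)
      (C := {U ∈ D | U ≤ Lp.const 2 P (r * 2 ^ (n + 1))} ∩ {U | inner ℝ h U ≤ 1})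
      ((hDc _).inter (isClosed_le (by fun_prop) continuous_const))
      ((hD.inter (convex_Iic _)).inter
        (convex_halfSpace_le (f := fun U => inner ℝ h U) (innerₛₗ ℝ h).isLinear 1))
      ((isBounded_setOf_nonneg_le_const (r * 2 ^ (n + 1))).subset
        fun U hU => ⟨hD0 U hU.1.1, hU.1.2⟩)
      (by positivity) (fun U hU hle => (hI U hU.1.1 hle).not_ge hU.2)
    refine ⟨f, hf0, hfI, add_nonneg h0 hf0, fun U hU hle => ?_⟩
    rw [inner_add_left]
    by_cases hc : inner ℝ h U ≤ 1
    · linarith [hf U ⟨⟨hU, hle⟩, hc⟩, inner_L2_nonneg h0 (hD0 U hU)]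
    · linarith [inner_L2_nonneg hf0 (hD0 U hU)]
  choose! F hF0 hFI hF using hstep
  let h : ℕ → Lp ℝ 2 P := fun n => Nat.rec 0 (fun n hn => hn + F n hn) n
  have hh : ∀ n, I n (h n) := by
    intro n
    induction n with
    | zero => exact ⟨le_rfl, fun U hU hle => (hDr U hU (by simpa using hle)).elim⟩
    | succ n ih => exact hF n _ ih
  let f : ℕ → Lp ℝ 2 P := fun n => F n (h n)
  have hf0 : ∀ n, 0 ≤ f n := fun n => hF0 n _ (hh n)
  have hsum : ∀ n, h n = ∑ k ∈ Finset.range n, f k := by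
    intro n
    induction n with
    | zero => rfl
    | succ n ih => rw [Finset.sum_range_succ, ← ih]
  have hmeas : ∀ n, AEMeasurable (fun ω => ENNReal.ofReal (f n ω)) P :=
    fun n => (Lp.aestronglyMeasurable (f n)).aemeasurable.ennreal_ofReal
  refine ⟨Measure.sum fun n => P.withDensity fun ω => ENNReal.ofReal (f n ω), ⟨?_⟩, ?_, ?_⟩
  · rw [Measure.sum_apply _ MeasurableSet.univ]
    have hle : ∀ n, (P.withDensity fun ω => ENNReal.ofReal (f n ω)) Set.univ ≤
        ENNReal.ofReal (1 / r * (1 / 2) ^ n) := by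
      intro n
      rw [withDensity_apply _ MeasurableSet.univ, setLIntegral_univ,
        ← ofReal_integral_eq_lintegral_ofReal ((Lp.memLp (f n)).integrable (by norm_num))
          ((Lp.coeFn_nonneg _).2 (hf0 n))]
      refine ENNReal.ofReal_le_ofReal ((hFI n _ (hh n)).trans_eq ?_)
      rw [one_div_mul_eq_div, one_div_pow, div_div, mul_comm]
    refine (ENNReal.tsum_le_tsum hle).trans_lt ?_
    rw [← ENNReal.ofReal_tsum_of_nonneg (fun n => by positivity)
      (summable_geometric_two.mul_left _)]
    exact ENNReal.ofReal_lt_top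
  · exact Measure.absolutelyContinuous_sum_left fun n => withDensity_absolutelyContinuous _ _
  · intro U hU
    obtain ⟨M, hM⟩ := hDM U hU
    obtain ⟨n, hn⟩ := pow_unbounded_of_one_lt (M / r) one_lt_two
    have hMn : M ≤ r * 2 ^ n := by rw [div_lt_iff₀ hr] at hn; linarith
    have hUn : U ≤ Lp.const 2 P (r * 2 ^ n) := by
      rw [le_const_iff_ae_le] at hM ⊢
      filter_upwards [hM] with ω h1 using h1.trans hMn
    have h1 := (hh n).2 U hU hUn
    have hterm : ∀ k, ∫⁻ ω, ENNReal.ofReal (U ω) ∂(P.withDensity fun ω => ENNReal.ofReal (f k ω))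
        = ENNReal.ofReal (inner ℝ (f k) U) := by
      intro k
      have hUae : AEMeasurable (fun ω => ENNReal.ofReal (U ω)) P :=
        (Lp.aestronglyMeasurable U).aemeasurable.ennreal_ofReal
      rw [lintegral_withDensity_eq_lintegral_mul₀ (hmeas k) hUae, inner_L2_eq_integral_mul,
        ofReal_integral_eq_lintegral_ofReal (f := fun ω => f k ω * U ω)
          ((Lp.memLp (f k)).integrable_mul (Lp.memLp U))]
      · refine lintegral_congr_ae ?_
        filter_upwards [(Lp.coeFn_nonneg _).2 (hf0 k)] with ω hω
        simp [ENNReal.ofReal_mul hω]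
      · filter_upwards [(Lp.coeFn_nonneg _).2 (hf0 k), (Lp.coeFn_nonneg _).2 (hD0 U hU)]
          with ω hω hω'
        exact mul_nonneg hω hω'
    rw [lintegral_sum_measure]
    simp only [hterm]
    -- The first `n` densities add up to `h n`, which already suffices for `U`.
    refine le_trans ?_ (ENNReal.sum_le_tsum (Finset.range n))
    rw [← ENNReal.ofReal_sum_of_nonneg fun k _ => inner_L2_nonneg (hf0 k) (hD0 U hU),
      ← sum_inner, ← hsum]
    exact ENNReal.one_le_ofReal.2 h1.le

/-! ### Strict separation from Fatou-closed convex sets by probability measures -/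

theorem memLp_top_iff_exists_bound {μ : Measure Ω} {f : Ω → ℝ} :
    MemLp f ∞ μ ↔ AEStronglyMeasurable f μ ∧ ∃ C : ℝ, ∀ᵐ ω ∂μ, |f ω| ≤ C := by
  constructor
  · intro h
    refine ⟨h.1, (eLpNorm f ∞ μ).toReal, ?_⟩
    have hfin : eLpNormEssSup f μ ≠ ∞ := by simpa [eLpNorm_exponent_top] using h.2.ne
    filter_upwards [ae_le_eLpNormEssSup (f := f) (μ := μ)] with ω hω
    rw [eLpNorm_exponent_top]
    simpa using ENNReal.toReal_mono hfin hω
  · rintro ⟨h, C, hC⟩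
    exact memLp_top_of_bound h C hC

theorem memLp_top_mono_ac {μ ν : Measure Ω} (h : ν ≪ μ) {f : Ω → ℝ} (hf : MemLp f ∞ μ) :
    MemLp f ∞ ν := by
  rw [memLp_top_iff_exists_bound] at hf ⊢
  exact ⟨hf.1.mono_ac h, hf.2.imp fun C hC => h.ae_le hC⟩

/-- A downward closed convex subset `A` of `L^∞`, closed under bounded a.s. limits, is strictly
separated from each point `W` outside by a probability measure `Q ≪ P`. -/
theorem exists_acProb_integral_lt {P : Measure Ω} [IsProbabilityMeasure P] {A : Set (Ω → ℝ)}
    (hA : ∀ Z ∈ A, MemLp Z ∞ P) (hconv : Convex ℝ A)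
    (hdown : ∀ Z ∈ A, ∀ Y, MemLp Y ∞ P → Y ≤ᵐ[P] Z → Y ∈ A)
    (hfatou : ∀ (Z : ℕ → Ω → ℝ) (Y : Ω → ℝ) (C : ℝ), (∀ n, Z n ∈ A) → MemLp Y ∞ P →
      (∀ n, ∀ᵐ ω ∂P, |Z n ω| ≤ C) → (∀ᵐ ω ∂P, Tendsto (fun n => Z n ω) atTop (𝓝 (Y ω))) → Y ∈ A)
    {W : Ω → ℝ} (hW : MemLp W ∞ P) (hWA : W ∉ A) :
    ∃ Q : ACProb P, ∀ Z ∈ A, ∫ ω, Z ω ∂Q.1 < ∫ ω, W ω ∂Q.1 := by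
  rcases A.eq_empty_or_nonempty with rfl | ⟨Z₀, hZ₀⟩
  · exact ⟨⟨P, inferInstance, Measure.AbsolutelyContinuous.rfl⟩, by simp⟩
  obtain ⟨CW, hCW⟩ := (memLp_top_iff_exists_bound.1 hW).2
  -- a margin around `W`
  have hgap : ∃ r : ℝ, 0 < r ∧ (fun ω => W ω - r) ∉ A := by
    by_contra! hcon
    refine hWA (hfatou (fun n ω => W ω - 1 / ((n : ℝ) + 1)) W (CW + 1)
      (fun n => hcon _ (by positivity)) hW (fun n => ?_) ?_)
    · filter_upwards [hCW] with ω hω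
      have h1 : 1 / ((n : ℝ) + 1) ≤ 1 := by
        rw [div_le_one (by positivity)]; linarith [Nat.cast_nonneg (α := ℝ) n]
      have h2 : 0 ≤ 1 / ((n : ℝ) + 1) := by positivity
      rw [abs_le] at hω ⊢
      constructor <;> linarith
    · filter_upwards with ω
      simpa using (tendsto_one_div_add_atTop_nhds_zero_nat (𝕜 := ℝ)).const_sub (W ω)
  obtain ⟨r, hr, hrA⟩ := hgap
  -- `D` collects the bounded nonnegative amounts whose subtraction brings `W` into `A`; the margin
  -- `r` says that no such amount is below `r`.
  let D : Set (Lp ℝ 2 P) :=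
    {U | 0 ≤ U ∧ (∃ M : ℝ, U ≤ Lp.const 2 P M) ∧ (fun ω => W ω - U ω) ∈ A}
  have hmemW : ∀ {U : Lp ℝ 2 P} {M : ℝ}, 0 ≤ U → U ≤ Lp.const 2 P M →
      MemLp (fun ω => W ω - U ω) ∞ P := by
    intro U M h0 hM
    refine hW.sub (memLp_top_iff_exists_bound.2 ⟨Lp.aestronglyMeasurable U, M, ?_⟩)
    filter_upwards [(Lp.coeFn_nonneg U).2 h0, le_const_iff_ae_le.1 hM] with ω h1 h2
    rwa [abs_of_nonneg h1]
  have hD : Convex ℝ D := by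
    rintro U ⟨hU0, ⟨M, hM⟩, hUA⟩ V ⟨hV0, ⟨N, hN⟩, hVA⟩ a b ha hb hab
    have h0 : 0 ≤ a • U + b • V := add_nonneg (smul_nonneg ha hU0) (smul_nonneg hb hV0)
    have hle : a • U + b • V ≤ Lp.const 2 P (a * M + b * N) := by
      have : Lp.const 2 P (a * M + b * N) = a • Lp.const 2 P M + b • Lp.const 2 P N := rfl
      rw [this]
      exact add_le_add (smul_le_smul_of_nonneg_left hM ha) (smul_le_smul_of_nonneg_left hN hb)
    refine ⟨h0, ⟨_, hle⟩, hdown _ (hconv hUA hVA ha hb hab) _ (hmemW h0 hle) ?_⟩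
    filter_upwards [Lp.coeFn_add (a • U) (b • V), Lp.coeFn_smul a U, Lp.coeFn_smul b V]
      with ω h1 h2 h3
    refine le_of_eq ?_
    simp only [h1, Pi.add_apply, h2, h3, Pi.smul_apply, smul_eq_mul]
    linear_combination (-W ω) * hab
  have hDc : ∀ M : ℝ, IsClosed {U ∈ D | U ≤ Lp.const 2 P M} := by
    intro M
    refine IsSeqClosed.isClosed fun U V hU hUV => ?_
    have hV0 : 0 ≤ V := ge_of_tendsto' hUV fun n => (hU n).1.1
    have hVM : V ≤ Lp.const 2 P M := le_of_tendsto' hUV fun n => (hU n).2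
    -- An a.s. convergent subsequence is uniformly bounded by the order bound `M`, so the Fatou
    -- property applies.
    obtain ⟨ns, -, hns⟩ := (tendstoInMeasure_of_tendsto_Lp hUV).exists_seq_tendsto_ae
    refine ⟨⟨hV0, ⟨M, hVM⟩, hfatou (fun n ω => W ω - U (ns n) ω) _ (CW + M)
      (fun n => (hU _).1.2.2) (hmemW hV0 hVM) (fun n => ?_) ?_⟩, hVM⟩
    · filter_upwards [hCW, (Lp.coeFn_nonneg _).2 (hU (ns n)).1.1,
        le_const_iff_ae_le.1 (hU (ns n)).2] with ω h1 h2 h3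
      have h2' : 0 ≤ U (ns n) ω := h2
      rw [abs_le] at h1 ⊢
      constructor <;> linarith
    · filter_upwards [hns] with ω hω using hω.const_sub _
  obtain ⟨μ, hμfin, hμP, hμ⟩ := exists_finite_measure_one_le_lintegral hD (fun U hU => hU.1)
    (fun U hU => hU.2.1) hDc hr (by
      rintro U ⟨hU0, -, hUA⟩ hle
      refine hrA (hdown _ hUA _ (hW.sub (memLp_const r)) ?_)
      filter_upwards [le_const_iff_ae_le.1 hle] with ω hω
      linarith)
  -- differences `W - Z` are bounded away from `0` in `L²(μ)`
  have hone : ∀ Z ∈ A, 1 ≤ eLpNorm (fun ω => W ω - Z ω) 2 μ * μ Set.univ ^ (1 / 2 : ℝ) := by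
    intro Z hZ
    have hWZ : MemLp (fun ω => W ω - Z ω) ∞ P := hW.sub (hA Z hZ)
    have hpos : MemLp (fun ω => max (W ω - Z ω) 0) ∞ P := hWZ.pos_part
    -- The positive part of `W - Z` belongs to `D`, since `W - (W - Z)⁺ ≤ Z`. Its `μ`-mean is at
    -- least `1`, and Hölder passes from `L¹(μ)` to `L²(μ)`.
    let U : Lp ℝ 2 P := (hpos.mono_exponent le_top).toLp _
    have hUeq : U =ᵐ[P] fun ω => max (W ω - Z ω) 0 := MemLp.coeFn_toLp _
    obtain ⟨C, hC⟩ := (memLp_top_iff_exists_bound.1 hpos).2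
    have hU0 : 0 ≤ U := (Lp.coeFn_nonneg U).1 <| by
      filter_upwards [hUeq] with ω hω
      rw [hω]
      exact le_max_right _ _
    have hUC : U ≤ Lp.const 2 P C := le_const_iff_ae_le.2 <| by
      filter_upwards [hUeq, hC] with ω hω hC
      rw [hω]
      exact (le_abs_self _).trans hC
    have hUD : U ∈ D := by
      refine ⟨hU0, ⟨C, hUC⟩, hdown Z hZ _ (hmemW hU0 hUC) ?_⟩
      filter_upwards [hUeq] with ω hω
      rw [hω]
      linarith [le_max_left (W ω - Z ω) 0]
    refine (hμ U hUD).trans ?_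
    have hle : ∫⁻ ω, ENNReal.ofReal (U ω) ∂μ ≤ eLpNorm (fun ω => W ω - Z ω) 1 μ := by
      rw [eLpNorm_one_eq_lintegral_enorm]
      refine lintegral_mono_ae ?_
      filter_upwards [hμP.ae_le hUeq] with ω hω
      rw [hω, ← ofReal_norm, Real.norm_eq_abs]
      exact ENNReal.ofReal_le_ofReal (max_le (le_abs_self _) (abs_nonneg _))
    refine hle.trans ((eLpNorm_le_eLpNorm_mul_rpow_measure_univ one_le_two
      (hWZ.1.mono_ac hμP)).trans_eq ?_)
    norm_num
  let K : Set (Lp ℝ 2 μ) := {V | ∃ Z ∈ A, V =ᵐ[μ] fun ω => W ω - Z ω}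
  have hK : Convex ℝ K := by
    rintro U ⟨Z, hZ, hUZ⟩ V ⟨Y, hY, hVY⟩ a b ha hb hab
    refine ⟨_, hconv hZ hY ha hb hab, ?_⟩
    filter_upwards [Lp.coeFn_add (a • U) (b • V), Lp.coeFn_smul a U, Lp.coeFn_smul b V, hUZ, hVY]
      with ω h1 h2 h3 h4 h5
    simp only [h1, Pi.add_apply, h2, h3, Pi.smul_apply, smul_eq_mul, h4, h5]
    linear_combination W ω * hab
  have hball : ∃ δ > 0, Disjoint (Metric.ball (0 : Lp ℝ 2 μ) δ) K := by
    refine ⟨1 / ((μ Set.univ ^ (1 / 2 : ℝ)).toReal + 1), by positivity,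
      Set.disjoint_left.2 ?_⟩
    rintro V hVδ ⟨Z, hZ, hVZ⟩
    rw [mem_ball_zero_iff, lt_div_iff₀ (by positivity), Lp.norm_def, eLpNorm_congr_ae hVZ] at hVδ
    have h1 := hone Z hZ
    have hfin : eLpNorm (fun ω => W ω - Z ω) 2 μ ≠ ∞ := by
      rw [← eLpNorm_congr_ae hVZ]; exact Lp.eLpNorm_ne_top V
    have hfin' : μ Set.univ ^ (1 / 2 : ℝ) ≠ ∞ :=
      ENNReal.rpow_ne_top_of_nonneg (by norm_num) (measure_ne_top μ _)
    have h2 := ENNReal.toReal_mono (ENNReal.mul_ne_top hfin hfin') h1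
    rw [ENNReal.toReal_mul, ENNReal.toReal_one] at h2
    nlinarith [ENNReal.toReal_nonneg (a := eLpNorm (fun ω => W ω - Z ω) 2 μ)]
  obtain ⟨δ, hδ, hdisj⟩ := hball
  obtain ⟨φ, u, h1, h2⟩ := geometric_hahn_banach_open (convex_ball _ _) Metric.isOpen_ball hK hdisj
  have hu : 0 < u := by simpa using h1 0 (Metric.mem_ball_self hδ)
  let f : Lp ℝ 2 μ := (InnerProductSpace.toDual ℝ (Lp ℝ 2 μ)).symm φ
  have hfK : ∀ V ∈ K, u ≤ inner ℝ f V := by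
    intro V hV
    rw [InnerProductSpace.toDual_symm_apply]
    exact h2 V hV
  have hmem2 : ∀ Z ∈ A, MemLp (fun ω => W ω - Z ω) 2 μ := fun Z hZ =>
    (memLp_top_mono_ac hμP (hW.sub (hA Z hZ))).mono_exponent le_top
  have hfA : ∀ Z ∈ A, u ≤ ∫ ω, f ω * (W ω - Z ω) ∂μ := by
    intro Z hZ
    refine (hfK _ ⟨Z, hZ, (hmem2 Z hZ).coeFn_toLp⟩).trans_eq ?_
    rw [inner_L2_eq_integral_mul]
    refine integral_congr_ae ?_
    filter_upwards [(hmem2 Z hZ).coeFn_toLp] with ω hω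
    rw [hω]
  -- As `A` is downward closed, `K` is stable under adding `t • 1_s` with `t ≥ 0`, along which the
  -- functional stays above `u`.
  have hf0 : 0 ≤ f := by
    refine L2_nonneg_of_setIntegral fun s hs => ?_
    refine nonneg_of_forall_le_add_mul (a := inner ℝ f ((hmem2 Z₀ hZ₀).toLp _)) (u := u)
      fun t ht => ?_
    rw [← inner_indicatorConstLp_one_right f hs, ← inner_smul_right, ← inner_add_right]
    have hind : MemLp (fun ω => Z₀ ω - t * s.indicator (fun _ => (1 : ℝ)) ω) ∞ P :=
      (hA Z₀ hZ₀).sub (((memLp_const (1 : ℝ)).indicator hs).const_mul t)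
    refine hfK _ ⟨_, hdown Z₀ hZ₀ _ hind (Eventually.of_forall fun ω =>
      sub_le_self _ (mul_nonneg ht (Set.indicator_nonneg (fun _ _ => zero_le_one) _))), ?_⟩
    filter_upwards [Lp.coeFn_add ((hmem2 Z₀ hZ₀).toLp _)
      (t • indicatorConstLp 2 hs (measure_ne_top μ s) (1 : ℝ)), (hmem2 Z₀ hZ₀).coeFn_toLp,
      Lp.coeFn_smul t (indicatorConstLp 2 hs (measure_ne_top μ s) (1 : ℝ)),
      indicatorConstLp_coeFn (p := 2) (hs := hs) (hμs := measure_ne_top μ s) (c := (1 : ℝ))]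
      with ω h1 h2 h3 h4
    rw [h1, Pi.add_apply, h2, h3, Pi.smul_apply, h4, smul_eq_mul]
    ring
  have hf0' : 0 ≤ᵐ[μ] f := (Lp.coeFn_nonneg f).2 hf0
  have hfint : Integrable f μ := (Lp.memLp f).integrable (by norm_num)
  -- A zero mean would make `f` vanish a.e., against `u > 0`; hence `f` can be normalised to a
  -- probability density.
  have hc : 0 < ∫ ω, f ω ∂μ := by
    refine (integral_nonneg_of_ae hf0').lt_of_ne fun h0 => ?_
    have hfz := (integral_eq_zero_iff_of_nonneg_ae hf0' hfint).1 h0.symm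
    refine (hu.trans_le (hfA Z₀ hZ₀)).ne' (integral_eq_zero_of_ae ?_)
    filter_upwards [hfz] with ω hω
    simp [hω]
  set c := ∫ ω, f ω ∂μ with hcdef
  have hgmeas : AEMeasurable (fun ω => ENNReal.ofReal (c⁻¹ * f ω)) μ :=
    ((Lp.aestronglyMeasurable f).aemeasurable.const_mul _).ennreal_ofReal
  have hg0 : 0 ≤ᵐ[μ] fun ω => c⁻¹ * f ω := by
    filter_upwards [hf0'] with ω hω using mul_nonneg (inv_nonneg.2 hc.le) hω
  have hQprob : IsProbabilityMeasure (μ.withDensity fun ω => ENNReal.ofReal (c⁻¹ * f ω)) := by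
    refine ⟨?_⟩
    rw [withDensity_apply _ MeasurableSet.univ, setLIntegral_univ,
      ← ofReal_integral_eq_lintegral_ofReal (hfint.const_mul _) hg0, integral_const_mul,
      ← hcdef, inv_mul_cancel₀ hc.ne', ENNReal.ofReal_one]
  have hQP : (μ.withDensity fun ω => ENNReal.ofReal (c⁻¹ * f ω)) ≪ P :=
    (withDensity_absolutelyContinuous _ _).trans hμP
  refine ⟨⟨_, hQprob, hQP⟩, fun Z hZ => ?_⟩
  have hintQ : ∀ Y : Ω → ℝ, MemLp Y ∞ P →
      Integrable Y (μ.withDensity fun ω => ENNReal.ofReal (c⁻¹ * f ω)) := fun Y hY =>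
    (memLp_top_mono_ac hQP hY).integrable le_top
  rw [← sub_pos, ← integral_sub (hintQ W hW) (hintQ Z (hA Z hZ)),
    integral_withDensity_eq_integral_toReal_smul₀ hgmeas
      (Eventually.of_forall fun _ => ENNReal.ofReal_lt_top)]
  have heq : ∫ ω, (ENNReal.ofReal (c⁻¹ * f ω)).toReal • (W ω - Z ω) ∂μ =
      c⁻¹ * ∫ ω, f ω * (W ω - Z ω) ∂μ := by
    rw [← integral_const_mul]
    refine integral_congr_ae ?_
    filter_upwards [hg0] with ω hω
    rw [ENNReal.toReal_ofReal hω, smul_eq_mul, mul_assoc]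
  rw [heq]
  exact mul_pos (inv_pos.2 hc) (hu.trans_le (hfA Z hZ))

variable {P : Measure Ω}

/-! ### The exponential bijection between `L^∞` and `L^∞_{++}` -/

theorem PosLinf.ae_pos (X : PosLinf P) : ∀ᵐ ω ∂P, 0 < X.1 ω := by
  obtain ⟨a, b, ha, h⟩ := X.2
  filter_upwards [h] with ω hω using ha.trans_le hω.1

theorem PosLinf.le_iff_ae {X Y : PosLinf P} : X ≤ Y ↔ ∀ᵐ ω ∂P, X.1 ω ≤ Y.1 ω :=
  AEEqFun.coeFn_le.symm

theorem PosLinf.ext_ae {X Y : PosLinf P} (h : ∀ᵐ ω ∂P, X.1 ω = Y.1 ω) : X = Y :=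
  Subtype.ext (AEEqFun.ext h)

theorem memLp_log (X : PosLinf P) : MemLp (fun ω => Real.log (X.1 ω)) ∞ P := by
  obtain ⟨a, b, ha, h⟩ := X.2
  refine memLp_top_iff_exists_bound.2
    ⟨(Real.measurable_log.comp_aemeasurable X.1.aestronglyMeasurable.aemeasurable).aestronglyMeasurable,
      max |Real.log a| |Real.log b|, ?_⟩
  filter_upwards [h] with ω hω
  exact abs_le_max_abs_abs (Real.log_le_log ha hω.1)
    (Real.log_le_log (ha.trans_le hω.1) hω.2)

theorem coeFn_expLinf (Z : Lp ℝ ∞ P) : (expLinf Z).1 =ᵐ[P] fun ω => Real.exp (Z ω) :=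
  AEEqFun.coeFn_mk _ _

theorem coeFn_expLinf_toLp {Z : Ω → ℝ} (hZ : MemLp Z ∞ P) :
    (expLinf (hZ.toLp Z)).1 =ᵐ[P] fun ω => Real.exp (Z ω) := by
  filter_upwards [coeFn_expLinf (hZ.toLp Z), hZ.coeFn_toLp] with ω h1 h2
  rw [h1, h2]

theorem expLinf_log (X : PosLinf P) : expLinf ((memLp_log X).toLp _) = X := by
  refine PosLinf.ext_ae ?_
  filter_upwards [coeFn_expLinf_toLp (memLp_log X), X.ae_pos] with ω h1 h2
  rw [h1, Real.exp_log h2]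

theorem coeFn_scale (lam : ℝ) (hlam : 0 < lam) (X : PosLinf P) :
    (X.scale lam hlam).1 =ᵐ[P] fun ω => lam * X.1 ω :=
  AEEqFun.coeFn_mk _ _

theorem coeFn_geom (α : ℝ) (hα : α ∈ Set.Ioo (0 : ℝ) 1) (X Y : PosLinf P) :
    (PosLinf.geom α hα X Y).1 =ᵐ[P] fun ω => X.1 ω ^ α * Y.1 ω ^ (1 - α) :=
  AEEqFun.coeFn_mk _ _

/-! ### The functional `E_Q[log X]` -/

theorem integrable_log (Q : ACProb P) (X : PosLinf P) :
    Integrable (fun ω => Real.log (X.1 ω)) Q.1 :=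
  have := Q.2.1
  (memLp_top_mono_ac Q.2.2 (memLp_log X)).integrable le_top

theorem expLog_expLinf (Q : ACProb P) (Z : Lp ℝ ∞ P) : expLog Q (expLinf Z) = ∫ ω, Z ω ∂Q.1 := by
  refine integral_congr_ae ?_
  filter_upwards [Q.2.2.ae_le (coeFn_expLinf Z)] with ω hω
  rw [hω, Real.log_exp]

theorem expLog_mono (Q : ACProb P) : Monotone (expLog Q) := by
  intro X Y hXY
  refine integral_mono_ae (integrable_log Q X) (integrable_log Q Y) (Q.2.2.ae_le ?_)
  filter_upwards [PosLinf.le_iff_ae.1 hXY, X.ae_pos] with ω h1 h2 using Real.log_le_log h2 h1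

theorem expLog_scale (Q : ACProb P) (lam : ℝ) (hlam : 0 < lam) (X : PosLinf P) :
    expLog Q (X.scale lam hlam) = expLog Q X + Real.log lam := by
  have := Q.2.1
  have h : expLog Q (X.scale lam hlam) = ∫ ω, (Real.log (X.1 ω) + Real.log lam) ∂Q.1 := by
    refine integral_congr_ae (Q.2.2.ae_le ?_)
    filter_upwards [coeFn_scale lam hlam X, X.ae_pos] with ω h1 h2
    rw [h1, Real.log_mul hlam.ne' h2.ne', add_comm]
  rw [h, integral_add (integrable_log Q X) (integrable_const _)]
  simp [expLog]

theorem expLog_geom (Q : ACProb P) (α : ℝ) (hα : α ∈ Set.Ioo (0 : ℝ) 1) (X Y : PosLinf P) :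
    expLog Q (PosLinf.geom α hα X Y) = α * expLog Q X + (1 - α) * expLog Q Y := by
  have h : expLog Q (PosLinf.geom α hα X Y) =
      ∫ ω, (α * Real.log (X.1 ω) + (1 - α) * Real.log (Y.1 ω)) ∂Q.1 := by
    refine integral_congr_ae (Q.2.2.ae_le ?_)
    filter_upwards [coeFn_geom α hα X Y, X.ae_pos, Y.ae_pos] with ω h1 h2 h3
    rw [h1, Real.log_mul (Real.rpow_pos_of_pos h2 _).ne' (Real.rpow_pos_of_pos h3 _).ne',
      Real.log_rpow h2, Real.log_rpow h3]
  rw [h, integral_add ((integrable_log Q X).const_mul _) ((integrable_log Q Y).const_mul _),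
    integral_const_mul, integral_const_mul]
  rfl

theorem tendsto_expLog (Q : ACProb P) {X : ℕ → PosLinf P} {Y : PosLinf P} (hX : Monotone X)
    (hXY : ∀ᵐ ω ∂P, Tendsto (fun n => (X n).1 ω) atTop (𝓝 (Y.1 ω))) :
    Tendsto (fun n => expLog Q (X n)) atTop (𝓝 (expLog Q Y)) := by
  refine integral_tendsto_of_tendsto_of_monotone (fun n => integrable_log Q (X n))
    (integrable_log Q Y) (Q.2.2.ae_le ?_) (Q.2.2.ae_le ?_)
  · filter_upwards [ae_all_iff.2 fun n => (X n).ae_pos,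
      ae_all_iff.2 fun n : ℕ => PosLinf.le_iff_ae.1 (hX n.le_succ)] with ω h1 h2
    exact monotone_nat_of_le_succ fun n => Real.log_le_log (h1 n) (h2 n)
  · filter_upwards [hXY, Y.ae_pos] with ω h1 h2
    exact (Real.continuousAt_log h2.ne').tendsto.comp h1

/-! ### Lower level sets -/

/-- The logarithms of the positions of risk at most `a`. -/
def logLevel (rho : PosLinf P → ℝ≥0∞) (a : ℝ≥0∞) : Set (Ω → ℝ) :=
  {Z | ∃ hZ : MemLp Z ∞ P, rho (expLinf (hZ.toLp Z)) ≤ a}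

theorem log_mem_logLevel {rho : PosLinf P → ℝ≥0∞} {a : ℝ≥0∞} {X : PosLinf P} :
    (fun ω => Real.log (X.1 ω)) ∈ logLevel rho a ↔ rho X ≤ a := by
  constructor
  · rintro ⟨_, h⟩
    rwa [expLinf_log] at h
  · intro h
    exact ⟨memLp_log X, by rwa [expLinf_log]⟩

theorem expLinf_toLp_le {Y Z : Ω → ℝ} (hY : MemLp Y ∞ P) (hZ : MemLp Z ∞ P) (h : Y ≤ᵐ[P] Z) :
    expLinf (hY.toLp Y) ≤ expLinf (hZ.toLp Z) := by
  rw [PosLinf.le_iff_ae]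
  filter_upwards [coeFn_expLinf_toLp hY, coeFn_expLinf_toLp hZ, h] with ω h1 h2 h3
  rw [h1, h2]
  exact Real.exp_le_exp.2 h3

theorem logLevel_down {rho : PosLinf P → ℝ≥0∞} (hmono : Monotone rho) {a : ℝ≥0∞} :
    ∀ Z ∈ logLevel rho a, ∀ Y, MemLp Y ∞ P → Y ≤ᵐ[P] Z → Y ∈ logLevel rho a := by
  rintro Z ⟨hZ, h⟩ Y hY hYZ
  exact ⟨hY, (hmono (expLinf_toLp_le hY hZ hYZ)).trans h⟩

/-- The exponential carries convex combinations to geometric mixtures. -/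
theorem convex_logLevel {rho : PosLinf P → ℝ≥0∞} (hq : QuasiLogconvex rho) (a : ℝ≥0∞) :
    Convex ℝ (logLevel rho a) := by
  refine convex_iff_forall_pos.2 ?_
  rintro Z ⟨hZ, hZa⟩ Y ⟨hY, hYa⟩ α β hα hβ hαβ
  obtain rfl : β = 1 - α := by linarith
  have hmix : MemLp (α • Z + (1 - α) • Y) ∞ P := (hZ.const_smul α).add (hY.const_smul _)
  have hα' : α ∈ Set.Ioo (0 : ℝ) 1 := ⟨hα, by linarith⟩
  refine ⟨hmix, ?_⟩
  have heq : expLinf (hmix.toLp _) =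
      PosLinf.geom α hα' (expLinf (hZ.toLp Z)) (expLinf (hY.toLp Y)) := by
    refine PosLinf.ext_ae ?_
    filter_upwards [coeFn_expLinf_toLp hmix, coeFn_geom α hα' (expLinf (hZ.toLp Z))
      (expLinf (hY.toLp Y)), coeFn_expLinf_toLp hZ, coeFn_expLinf_toLp hY] with ω h1 h2 h3 h4
    rw [h1, h2, h3, h4, ← Real.exp_mul, ← Real.exp_mul, ← Real.exp_add]
    simp [mul_comm]
  rw [heq]
  exact (hq α hα' _ _).trans (max_le hZa hYa)

/-- For a monotone map, continuity from below yields closedness of the level sets under bounded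
a.s. limits (the Fatou property). -/
theorem logLevel_fatou {rho : PosLinf P → ℝ≥0∞} (hmono : Monotone rho)
    (hcont : ContinuousFromBelow rho) {a : ℝ≥0∞} (Z : ℕ → Ω → ℝ) (Y : Ω → ℝ) (C : ℝ)
    (hZ : ∀ n, Z n ∈ logLevel rho a) (hY : MemLp Y ∞ P) (hC : ∀ n, ∀ᵐ ω ∂P, |Z n ω| ≤ C)
    (hlim : ∀ᵐ ω ∂P, Tendsto (fun n => Z n ω) atTop (𝓝 (Y ω))) : Y ∈ logLevel rho a := by
  refine ⟨hY, ?_⟩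
  -- The tail infima increase to `Y` and lie below `Z n`: continuity from below applies to them, and
  -- monotonicity keeps their risk at most `a`.
  let V : ℕ → Ω → ℝ := fun n ω => ⨅ k, Z (n + k) ω
  have hCall := ae_all_iff.2 hC
  have hbelow : ∀ {ω}, (∀ n, |Z n ω| ≤ C) → ∀ n, BddBelow (Set.range fun k => Z (n + k) ω) := by
    rintro ω hω n
    exact ⟨-C, by rintro _ ⟨k, rfl⟩; exact (abs_le.1 (hω _)).1⟩
  have hV : ∀ n, MemLp (V n) ∞ P := by
    intro n
    refine memLp_top_iff_exists_bound.2 ⟨(AEMeasurable.iInf fun k =>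
      (hZ (n + k)).1.1.aemeasurable).aestronglyMeasurable, C, ?_⟩
    filter_upwards [hCall] with ω hω
    rw [abs_le]
    exact ⟨le_ciInf fun k => (abs_le.1 (hω _)).1,
      (ciInf_le (hbelow hω n) 0).trans (abs_le.1 (hω _)).2⟩
  have hVmono : Monotone fun n => expLinf ((hV n).toLp _) := by
    refine monotone_nat_of_le_succ fun n => expLinf_toLp_le _ _ ?_
    filter_upwards [hCall] with ω hω
    refine le_ciInf fun k => ?_
    have := ciInf_le (hbelow hω n) (k + 1)
    rwa [show n + (k + 1) = n + 1 + k by ring] at this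
  have hVlim : ∀ᵐ ω ∂P, Tendsto (fun n => (expLinf ((hV n).toLp _)).1 ω) atTop
      (𝓝 ((expLinf (hY.toLp _)).1 ω)) := by
    filter_upwards [hCall, hlim, coeFn_expLinf_toLp hY,
      ae_all_iff.2 fun n => coeFn_expLinf_toLp (hV n)] with ω hω hl h1 h2
    simp only [h1, h2]
    refine (Real.continuous_exp.tendsto _).comp ?_
    rw [Metric.tendsto_atTop] at hl ⊢
    intro ε hε
    obtain ⟨N, hN⟩ := hl (ε / 2) (half_pos hε)
    refine ⟨N, fun n hn => ?_⟩
    have hk : ∀ k, |Z (n + k) ω - Y ω| < ε / 2 := fun k => hN _ (by omega)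
    rw [Real.dist_eq, abs_lt]
    have hlow : Y ω - ε / 2 ≤ V n ω :=
      le_ciInf fun k => by linarith [(abs_lt.1 (hk k)).1]
    have hup : V n ω ≤ Z (n + 0) ω := ciInf_le (hbelow hω n) 0
    constructor <;> linarith [(abs_lt.1 (hk 0)).2]
  refine le_of_tendsto' (hcont _ _ hVmono hVlim) fun n => ?_
  obtain ⟨hZn, hle⟩ := hZ n
  refine (hmono (expLinf_toLp_le (hV n) hZn ?_)).trans hle
  filter_upwards [hCall] with ω hω using ciInf_le (hbelow hω n) 0

/-! ### The canonical representation -/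

/-- For `b < rho X`, a measure separating `log X` from the level set at `b` leaves only positions of
risk above `b` in the infimum. The other inequality holds because `X` itself is admissible there. -/
theorem eq_iSup_exp_canonicalR [IsProbabilityMeasure P] {rho : PosLinf P → ℝ≥0∞}
    (hmono : Monotone rho) (hq : QuasiLogconvex rho) (hcont : ContinuousFromBelow rho)
    (X : PosLinf P) :
    rho X = ⨆ Q : ACProb P, EReal.exp (canonicalR rho (expLog Q X) Q) := by
  refine le_antisymm (le_of_forall_lt fun a ha => ?_) (iSup_le fun Q => ?_)
  · obtain ⟨b, hab, hb⟩ := exists_between ha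
    obtain ⟨Q, hQ⟩ := exists_acProb_integral_lt (A := logLevel rho b) (fun Z hZ => hZ.1)
      (convex_logLevel hq b) (logLevel_down hmono) (logLevel_fatou hmono hcont)
      (memLp_log X) (fun h => hb.not_ge (log_mem_logLevel.1 h))
    refine hab.trans_le (le_iSup_of_le Q ?_)
    rw [← ENNReal.exp_log b, EReal.exp_le_exp_iff]
    refine le_iInf₂ fun Y hY => ENNReal.log_le_log ?_
    by_contra! hlt
    exact hY.not_gt (hQ _ (log_mem_logLevel.2 hlt.le))
  · rw [← ENNReal.exp_log (rho X), EReal.exp_le_exp_iff]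
    exact iInf₂_le (f := fun (Y : PosLinf P) (_ : expLog Q X ≤ expLog Q Y) => ENNReal.log (rho Y))
      X le_rfl

/-- Since `t` is finite, no `∞ - ∞` arises and the exchange survives infinite `x` and `c`. -/
theorem ereal_le_coe_sub_comm {x c : EReal} {t : ℝ} : x ≤ (t : EReal) - c ↔ c ≤ (t : EReal) - x := by
  induction x with
  | bot => simp
  | top => induction c <;> simp [← EReal.coe_sub]
  | coe x =>
    induction c with
    | bot => simp
    | top => simp [← EReal.coe_sub]
    | coe c =>
      rw [← EReal.coe_sub, ← EReal.coe_sub, EReal.coe_le_coe_iff, EReal.coe_le_coe_iff]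
      exact le_sub_comm

theorem ereal_coe_sub_le_comm {x c : EReal} {t : ℝ} : (t : EReal) - x ≤ c ↔ (t : EReal) - c ≤ x := by
  induction x with
  | top => simp
  | bot => induction c <;> simp [← EReal.coe_sub]
  | coe x =>
    induction c with
    | top => simp
    | bot => simp [← EReal.coe_sub]
    | coe c =>
      rw [← EReal.coe_sub, ← EReal.coe_sub, EReal.coe_le_coe_iff, EReal.coe_le_coe_iff]
      exact sub_le_comm

theorem ereal_coe_sub_coe_sub (x : EReal) (t m : ℝ) :
    (t : EReal) - ((m : EReal) - x) = ((t - m : ℝ) : EReal) + x := by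
  induction x with
  | bot => simp
  | top => rw [EReal.coe_add_top]; simp
  | coe x => norm_cast; ring

theorem ereal_coe_add_sub (t h : ℝ) (c : EReal) :
    ((t + h : ℝ) : EReal) - c = ((t : EReal) - c) + (h : EReal) := by
  induction c <;> simp
  norm_cast
  ring

theorem continuous_coe_sub (c : EReal) : Continuous fun t : ℝ => (t : EReal) - c := by
  induction c with
  | bot => simpa using continuous_const
  | top => simpa using continuous_const
  | coe c =>
    have : (fun t : ℝ => (t : EReal) - (c : EReal)) = fun t : ℝ => ((t - c : ℝ) : EReal) := by
      ext t; norm_cast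
    rw [this]
    exact continuous_coe_real_ereal.comp (continuous_id.sub continuous_const)

/-- Homogeneity removes the constraint: every `exp Z` can be rescaled to meet `E_Q[log Y] = t`,
which shifts `log rho` by `t - E_Q[Z]`. Conversely, an admissible `Y` is tested in the penalty
through `Z = log Y`. -/
theorem canonicalR_eq_sub_minimalPenalty {rho : PosLinf P → ℝ≥0∞}
    (hhom : PositivelyHomogeneous rho) (t : ℝ) (Q : ACProb P) :
    canonicalR rho t Q = (t : EReal) - minimalPenalty rho Q := by
  refine le_antisymm ?_ (le_iInf₂ fun Y hY => ?_)
  · rw [ereal_le_coe_sub_comm]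
    refine iSup_le fun Z => ?_
    rw [← ereal_le_coe_sub_comm, ereal_coe_sub_coe_sub]
    refine (iInf₂_le ((expLinf Z).scale (Real.exp (t - ∫ ω, Z ω ∂Q.1)) (Real.exp_pos _))
      ?_).trans_eq ?_
    · rw [expLog_scale, expLog_expLinf, Real.log_exp]
      linarith
    · rw [hhom, ENNReal.log_mul_add, ENNReal.log_ofReal_of_pos (Real.exp_pos _), Real.log_exp]
      rfl
  · have h1 := le_iSup (fun Z : Lp ℝ ∞ P => ((∫ ω, Z ω ∂Q.1 : ℝ) : EReal) - arithmetic rho Z)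
      ((memLp_log Y).toLp _)
    simp only [arithmetic] at h1
    rw [← expLog_expLinf, expLinf_log] at h1
    refine (EReal.sub_le_sub le_rfl h1).trans ?_
    rw [ereal_coe_sub_coe_sub]
    refine (add_le_add_left (EReal.coe_le_coe_iff.2 (sub_nonpos.2 hY)) _).trans_eq ?_
    rw [EReal.coe_zero, zero_add]

theorem dualRep_canonicalR [IsProbabilityMeasure P] {rho : PosLinf P → ℝ≥0∞}
    (hmono : Monotone rho) (hq : QuasiLogconvex rho) (hcont : ContinuousFromBelow rho)
    (hhom : PositivelyHomogeneous rho) :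
    DualRep rho Set.univ (fun t Q => canonicalR rho t Q.1) := by
  refine ⟨fun Q s t hst => ?_, fun Q t => ?_, fun X => ?_⟩
  · exact le_iInf₂ fun Y hY => iInf₂_le Y (hst.trans hY)
  · simp only [canonicalR_eq_sub_minimalPenalty hhom]
    exact (continuous_coe_sub _).continuousWithinAt
  · rw [eq_iSup_exp_canonicalR hmono hq hcont X]
    exact (Equiv.Set.univ (ACProb P)).symm.iSup_congr fun _ => rfl

theorem translationInvariant_canonicalR {rho : PosLinf P → ℝ≥0∞}
    (hhom : PositivelyHomogeneous rho) :
    TranslationInvariant (𝓠 := (Set.univ : Set (ACProb P))) (fun t Q => canonicalR rho t Q.1) := by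
  intro t h Q
  simp only [canonicalR_eq_sub_minimalPenalty hhom]
  exact ereal_coe_add_sub t h _

/-! ### Passing between `R` and `exp R` -/

theorem dualRep_iff_dualRepExp {rho : PosLinf P → ℝ≥0∞} {𝓠 : Set (ACProb P)}
    {R : ℝ → 𝓠 → EReal} :
    DualRep rho 𝓠 R ↔ DualRepExp rho 𝓠 (fun t Q => EReal.exp (R t Q)) := by
  refine and_congr (forall_congr' fun Q => ?_) (and_congr (forall₂_congr fun Q t => ?_) Iff.rfl)
  · exact ⟨fun h _ _ hst => EReal.exp_monotone (h hst),
      fun h _ _ hst => EReal.exp_le_exp_iff.1 (h hst)⟩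
  · exact (EReal.expHomeomorph.comp_continuousWithinAt_iff _ _ _)

theorem translationInvariant_iff {𝓠 : Set (ACProb P)} {R : ℝ → 𝓠 → EReal} :
    TranslationInvariant R ↔ MultiplicativelyHomogeneous (fun t Q => EReal.exp (R t Q)) := by
  refine forall₃_congr fun t h Q => ?_
  rw [← EReal.exp_coe, mul_comm, ← EReal.exp_add, EReal.exp_strictMono.injective.eq_iff]

/-- Translation invariance determines `R` from its value at `0`, so `c Q = -R 0 Q`. Each term of the
supremum is at most `rho (exp Z)`; solving for `c Q` gives the bound. -/
theorem exists_penalty {rho : PosLinf P → ℝ≥0∞} {𝓠 : Set (ACProb P)} {R : ℝ → 𝓠 → EReal}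
    (hR : DualRep rho 𝓠 R) (hT : TranslationInvariant R) :
    ∃ c : 𝓠 → EReal, (∀ (t : ℝ) (Q : 𝓠), R t Q = (t : EReal) - c Q) ∧
      ∀ Q : 𝓠, minimalPenalty rho Q.1 ≤ c Q := by
  have hc : ∀ (t : ℝ) (Q : 𝓠), R t Q = (t : EReal) - -R 0 Q := by
    intro t Q
    have := hT 0 t Q
    rwa [zero_add, add_comm, ← neg_neg (R 0 Q), ← sub_eq_add_neg] at this
  refine ⟨fun Q => -R 0 Q, hc, fun Q => iSup_le fun Z => ?_⟩
  rw [ereal_coe_sub_le_comm, ← hc,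
    ← expLog_expLinf, arithmetic, ← EReal.exp_le_exp_iff, ENNReal.exp_log, hR.2.2 (expLinf Z)]
  exact le_iSup (fun Q : 𝓠 => EReal.exp (R (expLog Q.1 (expLinf Z)) Q)) Q

/-! ### Properties of the represented maps -/

section Represented

variable {rho : PosLinf P → ℝ≥0∞} {𝓠 : Set (ACProb P)} {S : ℝ → 𝓠 → ℝ≥0∞}

theorem DualRepExp.monotone (hS : DualRepExp rho 𝓠 S) : Monotone rho := by
  intro X Y hXY
  rw [hS.2.2 X, hS.2.2 Y]
  exact iSup_mono fun Q => hS.1 Q (expLog_mono Q.1 hXY)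

/-- The means `E_Q[log X_n]` converge from the left, so left continuity of `S` makes each term a
supremum over `n`, and the two suprema commute. -/
theorem DualRepExp.continuousFromBelow (hS : DualRepExp rho 𝓠 S) : ContinuousFromBelow rho := by
  intro X Y hX hXY
  have hXle : ∀ n, X n ≤ Y := by
    intro n
    rw [PosLinf.le_iff_ae]
    filter_upwards [hXY, ae_all_iff.2 fun n : ℕ => PosLinf.le_iff_ae.1 (hX n.le_succ)] with ω h1 h2
    exact (monotone_nat_of_le_succ (f := fun n => (X n).1 ω) h2).ge_of_tendsto h1 n
  have hQ : ∀ Q : 𝓠, S (expLog Q.1 Y) Q = ⨆ n, S (expLog Q.1 (X n)) Q := by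
    intro Q
    refine tendsto_nhds_unique ((hS.2.1 Q _).tendsto.comp
      (tendsto_nhdsWithin_iff.2 ⟨tendsto_expLog Q.1 hX hXY,
        Eventually.of_forall fun n => expLog_mono Q.1 (hXle n)⟩))
      (tendsto_atTop_iSup fun m n hmn => hS.1 Q (expLog_mono Q.1 (hX hmn)))
  have hsup : rho Y = ⨆ n, rho (X n) := by
    rw [hS.2.2 Y]
    simp only [hQ, hS.2.2 (X _)]
    exact iSup_comm
  rw [hsup]
  exact tendsto_atTop_iSup fun m n hmn => hS.monotone (hX hmn)

theorem MultiplicativelyHomogeneous.eq_mul (hH : MultiplicativelyHomogeneous S) (t : ℝ) (Q : 𝓠) :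
    S t Q = ENNReal.ofReal (Real.exp t) * S 0 Q := by
  rw [← hH 0 t Q, zero_add]

theorem DualRepExp.logconvex (hS : DualRepExp rho 𝓠 S) (hH : MultiplicativelyHomogeneous S) :
    Logconvex rho := by
  refine ⟨hS.monotone, fun lam hlam X => ?_, fun α hα X Y => ?_⟩
  · rw [hS.2.2, hS.2.2 X, ENNReal.mul_iSup]
    refine iSup_congr fun Q => ?_
    rw [expLog_scale, hH, Real.exp_log hlam]
  · have hα0 : 0 ≤ α := hα.1.le
    have hα1 : 0 ≤ 1 - α := sub_nonneg.2 hα.2.le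
    rw [hS.2.2 (PosLinf.geom α hα X Y)]
    refine iSup_le fun Q => ?_
    -- For fixed `Q` logconvexity is an equality, because `S` is exponential in `t` and `E_Q[log ·]`
    -- is affine along mixtures.
    have key : S (expLog Q.1 (PosLinf.geom α hα X Y)) Q =
        S (expLog Q.1 X) Q ^ α * S (expLog Q.1 Y) Q ^ (1 - α) := by
      rw [hH.eq_mul, hH.eq_mul (expLog Q.1 X), hH.eq_mul (expLog Q.1 Y), expLog_geom,
        ENNReal.mul_rpow_of_nonneg _ _ hα0, ENNReal.mul_rpow_of_nonneg _ _ hα1,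
        mul_mul_mul_comm, ← ENNReal.rpow_add_of_nonneg _ _ hα0 hα1,
        ENNReal.ofReal_rpow_of_pos (Real.exp_pos _), ENNReal.ofReal_rpow_of_pos (Real.exp_pos _),
        ← ENNReal.ofReal_mul (by positivity), ← Real.exp_mul, ← Real.exp_mul, ← Real.exp_add,
        add_sub_cancel, ENNReal.rpow_one, mul_comm α, mul_comm (1 - α)]
    rw [key, hS.2.2 X, hS.2.2 Y]
    exact mul_le_mul'
      (ENNReal.rpow_le_rpow (le_iSup (fun Q : 𝓠 => S (expLog Q.1 X) Q) Q) hα0)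
      (ENNReal.rpow_le_rpow (le_iSup (fun Q : 𝓠 => S (expLog Q.1 Y) Q) Q) hα1)

theorem Logconvex.quasiLogconvex (h : Logconvex rho) : QuasiLogconvex rho := by
  intro α hα X Y
  have hα0 : 0 ≤ α := hα.1.le
  have hα1 : 0 ≤ 1 - α := sub_nonneg.2 hα.2.le
  refine (h.2.2 α hα X Y).trans ((mul_le_mul' (ENNReal.rpow_le_rpow (le_max_left _ (rho Y)) hα0)
    (ENNReal.rpow_le_rpow (le_max_right (rho X) _) hα1)).trans_eq ?_)
  rw [← ENNReal.rpow_add_of_nonneg _ _ hα0 hα1, add_sub_cancel, ENNReal.rpow_one]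

end Represented

end RiskMeasure

/-! ### The representation theorem -/

theorem mainTheorem3 {Ω : Type*} [MeasurableSpace Ω] (P : MeasureTheory.Measure Ω)
    [MeasureTheory.IsProbabilityMeasure P] (rho : RiskMeasure.PosLinf P → ℝ≥0∞) :
    -- the four equivalent statements
    List.TFAE [
      Monotone rho ∧ RiskMeasure.QuasiLogconvex rho ∧ RiskMeasure.ContinuousFromBelow rho ∧
        RiskMeasure.PositivelyHomogeneous rho,
      RiskMeasure.Logconvex rho ∧ RiskMeasure.ContinuousFromBelow rho,
      ∃ (𝓠 : Set (RiskMeasure.ACProb P)) (R : ℝ → 𝓠 → EReal),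
        RiskMeasure.DualRep rho 𝓠 R ∧ RiskMeasure.TranslationInvariant R,
      ∃ (𝓠 : Set (RiskMeasure.ACProb P)) (S : ℝ → 𝓠 → ℝ≥0∞),
        RiskMeasure.DualRepExp rho 𝓠 S ∧ RiskMeasure.MultiplicativelyHomogeneous S] ∧
    -- for each `R`, the conditions on `R` and on `exp R` are equivalent
    (∀ (𝓠 : Set (RiskMeasure.ACProb P)) (R : ℝ → 𝓠 → EReal),
      (RiskMeasure.DualRep rho 𝓠 R ∧ RiskMeasure.TranslationInvariant R) ↔
      (RiskMeasure.DualRepExp rho 𝓠 (fun t Q => EReal.exp (R t Q)) ∧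
        RiskMeasure.MultiplicativelyHomogeneous (fun t Q => EReal.exp (R t Q)))) ∧
    -- every such `R` has the form `t - c(Q)`, with `c` at least the minimal penalty
    (∀ (𝓠 : Set (RiskMeasure.ACProb P)) (R : ℝ → 𝓠 → EReal),
      RiskMeasure.DualRep rho 𝓠 R → RiskMeasure.TranslationInvariant R →
      ∃ c : 𝓠 → EReal, (∀ (t : ℝ) (Q : 𝓠), R t Q = (t : EReal) - c Q) ∧
        ∀ Q : 𝓠, RiskMeasure.minimalPenalty rho Q.1 ≤ c Q) ∧
    -- the canonical `R`, on all `Q ≪ P`, is such a functional, with `c` the minimal penalty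
    ((Monotone rho ∧ RiskMeasure.QuasiLogconvex rho ∧ RiskMeasure.ContinuousFromBelow rho ∧
        RiskMeasure.PositivelyHomogeneous rho) →
      RiskMeasure.DualRep rho Set.univ (fun t Q => RiskMeasure.canonicalR rho t Q.1) ∧
      RiskMeasure.TranslationInvariant (𝓠 := (Set.univ : Set (RiskMeasure.ACProb P)))
        (fun t Q => RiskMeasure.canonicalR rho t Q.1) ∧
      ∀ (t : ℝ) (Q : RiskMeasure.ACProb P),
        RiskMeasure.canonicalR rho t Q = (t : EReal) - RiskMeasure.minimalPenalty rho Q) := by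
  refine ⟨?_, fun 𝓠 R => ?_, fun 𝓠 R hR hT => RiskMeasure.exists_penalty hR hT, ?_⟩
  · tfae_have 1 → 3 := fun ⟨hm, hq, hc, hh⟩ =>
      ⟨Set.univ, _, RiskMeasure.dualRep_canonicalR hm hq hc hh,
        RiskMeasure.translationInvariant_canonicalR hh⟩
    tfae_have 3 → 4 := fun ⟨𝓠, R, hR, hT⟩ =>
      ⟨𝓠, _, RiskMeasure.dualRep_iff_dualRepExp.1 hR, RiskMeasure.translationInvariant_iff.1 hT⟩
    tfae_have 4 → 2 := fun ⟨_, _, hS, hH⟩ => ⟨hS.logconvex hH, hS.continuousFromBelow⟩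
    tfae_have 2 → 1 := fun ⟨hl, hc⟩ => ⟨hl.1, hl.quasiLogconvex, hc, hl.2.1⟩
    tfae_finish
  · exact and_congr RiskMeasure.dualRep_iff_dualRepExp RiskMeasure.translationInvariant_iff
  · rintro ⟨hm, hq, hc, hh⟩
    exact ⟨RiskMeasure.dualRep_canonicalR hm hq hc hh,
      RiskMeasure.translationInvariant_canonicalR hh,
      RiskMeasure.canonicalR_eq_sub_minimalPenalty hh⟩
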